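/- Let $X$ be a real Hilbert space, $m\ge 1$ an integer, and $R\colon X\to X$ a linear isometry with $R^m=I_X$. Put $A:=\frac1m\sum_{i=1}^m R^i$, $Y:=\{y\in X: Ay=0\}$ and $S:=R-I_X$. Let $C\subset X$ be nonempty, closed and convex, let $\sigma_C\colon X\to(-\infty,+\infty]$, $\sigma_C(t):=\sup_{c\in C}\langle c,t\rangle$, be its support function, and let $D:=\{y\in Y:\ \sigma_C(y)+\frac12\|y\|^2\le 0\}$. Then there exist $d,e\in Y$ such that $$\sigma_C(Se)+\langle Sx-Se,\,e\rangle-\sigma_C(Sx)\le 0\quad\text{for all }x\in X,$$ and $d=Se\in D$. (In particular $\sigma_C(Se)$ is finite, so the left-hand side is well defined in $[-\infty,+\infty)$.) -/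

import Mathlib

open scoped InnerProductSpace

namespace CyclicProjections

noncomputable section

/-- The average operator `A = (1/m) ∑_{i=1}^{m} R^i` of a linear map `R`. -/
def avgOp {X : Type*} [AddCommGroup X] [Module ℝ X] (R : X →ₗ[ℝ] X) (m : ℕ) : X →ₗ[ℝ] X :=
  (1 / (m : ℝ)) • ∑ i ∈ Finset.Icc 1 m, R ^ i

/-- The subspace `Y = {y ∈ X : A y = 0}`. -/
def avgKer {X : Type*} [AddCommGroup X] [Module ℝ X] (R : X →ₗ[ℝ] X) (m : ℕ) :
    Submodule ℝ X :=
  LinearMap.ker (avgOp R m)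

/-- The operator `S = R - I`. -/
def diffOp {X : Type*} [AddCommGroup X] [Module ℝ X] (R : X →ₗ[ℝ] X) : X →ₗ[ℝ] X :=
  R - LinearMap.id

/-- The support function `σ_C(t) = sup_{c ∈ C} ⟨c, t⟩`, with values in the extended reals. -/
def supportFn {X : Type*} [NormedAddCommGroup X] [InnerProductSpace ℝ X] (C : Set X) (t : X) :
    EReal :=
  ⨆ c ∈ C, ((⟪c, t⟫_ℝ : ℝ) : EReal)

/-- The set `D = {y ∈ Y : σ_C(y) + ½‖y‖² ≤ 0}`. -/
def setD {X : Type*} [NormedAddCommGroup X] [InnerProductSpace ℝ X] (R : X →ₗ[ℝ] X) (m : ℕ)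
    (C : Set X) : Set (avgKer R m) :=
  {y | supportFn C (y : X) + (((1 / 2 : ℝ) * ‖(y : X)‖ ^ 2 : ℝ) : EReal) ≤ 0}

end

end CyclicProjections

namespace CyclicProjections

section VariationalInequality

variable {H : Type*} [NormedAddCommGroup H] [InnerProductSpace ℝ H]

/-! Let `K` be the closure of the projection of `C` to `Y`. It suffices to find `e ∈ K` with `⟪Se, k
- e⟫ ≤ 0` on `K`: then `σ_C(Se) = ⟪e, Se⟫`, which is `-½‖Se‖²` because `R` is an isometry, so `Se ∈
D`; and the inequality for `x` reduces to `⟪e, Sx⟫ ≤ σ_C(Sx)`, true since `e ∈ K` and `Sx ∈ Y`. Such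
an `e` is a fixed point of `v ↦ P_K(v + Sv/2)`. Banach's theorem applies because `‖y + Sy/2‖² = ‖y‖²
- ¼‖Sy‖²`, while `‖y‖ ≤ m‖Sy‖` on `Y`. -/

/-- Two points satisfying the obtuse angle criterion are at most as far apart as the points they
are projections of. -/
lemma norm_sub_le_of_inner_le_zero {K : Set H} {u v p q : H} (hp : p ∈ K) (hq : q ∈ K)
    (hup : ∀ w ∈ K, ⟪u - p, w - p⟫_ℝ ≤ 0) (hvq : ∀ w ∈ K, ⟪v - q, w - q⟫_ℝ ≤ 0) :
    ‖p - q‖ ≤ ‖u - v‖ := by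
  have h₁ := hup q hq
  have h₂ := hvq p hp
  have h₃ : ⟪p - q, p - q⟫_ℝ ≤ ⟪u - v, p - q⟫_ℝ := by
    have : ⟪u - v, p - q⟫_ℝ - ⟪p - q, p - q⟫_ℝ
        = -(⟪u - p, q - p⟫_ℝ + ⟪v - q, p - q⟫_ℝ) := by
      rw [← inner_sub_left, ← neg_sub p q, inner_neg_right, neg_add, neg_neg, ← sub_eq_add_neg,
        ← inner_sub_left]
      congr 1
      abel
    linarith
  rw [real_inner_self_eq_norm_sq] at h₃
  have h₄ := real_inner_le_norm (u - v) (p - q)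
  by_contra! h
  nlinarith [norm_nonneg (u - v), norm_nonneg (p - q)]

/-- A variational inequality over a nonempty closed convex set of a Hilbert space has a solution
as soon as `v ↦ v + F v` is a strict contraction. -/
lemma exists_inner_le_zero_of_contractingWith [CompleteSpace H] {K : Set H} (hne : K.Nonempty)
    (hK : IsClosed K) (hconv : Convex ℝ K) {F : H → H} {q : NNReal}
    (hF : ContractingWith q fun v ↦ v + F v) :
    ∃ e ∈ K, ∀ k ∈ K, ⟪F e, k - e⟫_ℝ ≤ 0 := by
  have hproj : ∀ u : H, ∃ p ∈ K, ∀ w ∈ K, ⟪u - p, w - p⟫_ℝ ≤ 0 := fun u ↦ by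
    obtain ⟨p, hp, hmin⟩ := exists_norm_eq_iInf_of_complete_convex hne hK.isComplete hconv u
    exact ⟨p, hp, (norm_eq_iInf_iff_real_inner_le_zero hconv hp).1 hmin⟩
  choose P hPK hP using hproj
  have hcontr : ContractingWith q fun v ↦ P (v + F v) := by
    refine ⟨hF.1, LipschitzWith.of_dist_le_mul fun u v ↦ ?_⟩
    refine le_trans ?_ (hF.2.dist_le_mul u v)
    simpa only [dist_eq_norm] using
      norm_sub_le_of_inner_le_zero (hPK _) (hPK _) (hP (u + F u)) (hP (v + F v))
  have hfix : P (hcontr.fixedPoint + F hcontr.fixedPoint) = hcontr.fixedPoint :=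
    hcontr.fixedPoint_isFixedPt
  refine ⟨hcontr.fixedPoint, hfix ▸ hPK _, fun k hk ↦ ?_⟩
  simpa [hfix] using hP (hcontr.fixedPoint + F hcontr.fixedPoint) k hk

end VariationalInequality

section Average

variable {X : Type*} [AddCommGroup X] [Module ℝ X]

lemma avgOp_apply (R : X →ₗ[ℝ] X) (m : ℕ) (x : X) :
    avgOp R m x = (1 / (m : ℝ)) • ∑ i ∈ Finset.Icc 1 m, (R ^ i) x := by
  simp [avgOp]

lemma diffOp_apply (R : X →ₗ[ℝ] X) (x : X) : diffOp R x = R x - x := rfl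

/-- The range of `R - I` lies in the kernel of the average. -/
lemma diffOp_mem_avgKer {R : X →ₗ[ℝ] X} {m : ℕ} (hR : R ^ m = LinearMap.id) (x : X) :
    diffOp R x ∈ avgKer R m := by
  have hsum : ∑ i ∈ Finset.Icc 1 m, (R ^ i) (diffOp R x) = 0 := by
    have hterm : ∀ i, (R ^ i) (diffOp R x) = (R ^ (i + 1)) x - (R ^ i) x := fun i ↦ by
      rw [diffOp_apply, map_sub, pow_succ, Module.End.mul_apply]
    simp only [hterm]
    -- The sum telescopes to `R^(m+1) x - R x`, which vanishes as `R^m = I`.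
    rw [← Finset.Ico_add_one_right_eq_Icc,
      Finset.sum_Ico_sub (fun i ↦ (R ^ i) x) (Nat.le_add_left 1 m), pow_succ, hR]
    simp
  rw [avgKer, LinearMap.mem_ker, avgOp_apply, hsum, smul_zero]

/-- `S = R - I` as an endomorphism of `Y`. -/
noncomputable def diffOpAvgKer {R : X →ₗ[ℝ] X} {m : ℕ} (hR : R ^ m = LinearMap.id) :
    avgKer R m →ₗ[ℝ] avgKer R m :=
  ((diffOp R).comp (avgKer R m).subtype).codRestrict (avgKer R m)
    fun y ↦ diffOp_mem_avgKer hR y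

@[simp]
lemma coe_diffOpAvgKer {R : X →ₗ[ℝ] X} {m : ℕ} (hR : R ^ m = LinearMap.id) (y : avgKer R m) :
    (diffOpAvgKer hR y : X) = diffOp R y := rfl

end Average

section Isometry

variable {X : Type*} [NormedAddCommGroup X] [InnerProductSpace ℝ X] (R : X →ₗᵢ[ℝ] X)

lemma continuous_pow_apply (i : ℕ) : Continuous fun x ↦ (R.toLinearMap ^ i) x := by
  simp only [Module.End.pow_apply]
  exact R.continuous.iterate i

lemma isClosed_avgKer (m : ℕ) : IsClosed (avgKer R.toLinearMap m : Set X) := by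
  have hcont : Continuous fun x ↦ avgOp R.toLinearMap m x := by
    simp only [avgOp_apply]
    exact (continuous_finsetSum _ fun i _ ↦ continuous_pow_apply R i).const_smul _
  exact isClosed_singleton.preimage hcont

/-- Each further application of the isometry `R` adds at most one step of length `‖Sx‖`. -/
lemma norm_pow_apply_sub_le (i : ℕ) (x : X) :
    ‖(R.toLinearMap ^ i) x - x‖ ≤ i * ‖diffOp R.toLinearMap x‖ := by
  induction i with
  | zero => simp
  | succ i ih =>
    have hsplit : (R.toLinearMap ^ (i + 1)) x - x
        = R ((R.toLinearMap ^ i) x - x) + diffOp R.toLinearMap x := by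
      rw [pow_succ', Module.End.mul_apply, diffOp_apply, map_sub]
      simp
    calc ‖(R.toLinearMap ^ (i + 1)) x - x‖
        ≤ ‖R ((R.toLinearMap ^ i) x - x)‖ + ‖diffOp R.toLinearMap x‖ := hsplit ▸ norm_add_le _ _
      _ ≤ i * ‖diffOp R.toLinearMap x‖ + ‖diffOp R.toLinearMap x‖ := by
          rw [R.norm_map]; gcongr
      _ = (i + 1 : ℕ) * ‖diffOp R.toLinearMap x‖ := by push_cast; ring

/-- `S = R - I` is bounded below on `Y`. -/
lemma norm_le_mul_norm_diffOp {m : ℕ} (hm : 1 ≤ m) {y : X} (hy : y ∈ avgKer R.toLinearMap m) :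
    ‖y‖ ≤ m * ‖diffOp R.toLinearMap y‖ := by
  have hm' : (0 : ℝ) < m := by exact_mod_cast hm
  have hsum : ∑ i ∈ Finset.Icc 1 m, (R.toLinearMap ^ i) y = 0 := by
    rw [avgKer, LinearMap.mem_ker, avgOp_apply] at hy
    exact (smul_eq_zero.1 hy).resolve_left (by positivity)
  have hneg : ∑ i ∈ Finset.Icc 1 m, ((R.toLinearMap ^ i) y - y) = -((m : ℝ) • y) := by
    rw [Finset.sum_sub_distrib, hsum]
    simp [Nat.cast_smul_eq_nsmul]
  have hle : (m : ℝ) * ‖y‖ ≤ m * (m * ‖diffOp R.toLinearMap y‖) := by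
    calc (m : ℝ) * ‖y‖ = ‖∑ i ∈ Finset.Icc 1 m, ((R.toLinearMap ^ i) y - y)‖ := by
          rw [hneg, norm_neg, norm_smul, Real.norm_natCast]
      _ ≤ ∑ i ∈ Finset.Icc 1 m, (m : ℝ) * ‖diffOp R.toLinearMap y‖ := by
          refine norm_sum_le_of_le _ fun i hi ↦ (norm_pow_apply_sub_le R i y).trans ?_
          gcongr
          exact (Finset.mem_Icc.1 hi).2
      _ = m * (m * ‖diffOp R.toLinearMap y‖) := by simp
  exact le_of_mul_le_mul_left hle hm'

lemma inner_diffOp_self (x : X) :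
    ⟪x, diffOp R.toLinearMap x⟫_ℝ = -(1 / 2 * ‖diffOp R.toLinearMap x‖ ^ 2) := by
  have hR : ‖R.toLinearMap x‖ = ‖x‖ := R.norm_map x
  rw [diffOp_apply, norm_sub_sq_real, hR, inner_sub_right, real_inner_self_eq_norm_sq,
    real_inner_comm]
  ring

/-- `I + S/2 = (I + R)/2` is a strict contraction on `Y`. -/
lemma exists_contractingWith_add_half_diffOp {m : ℕ} (hm : 1 ≤ m)
    (hR : R.toLinearMap ^ m = LinearMap.id) :
    ∃ q : NNReal, ContractingWith q
      fun y : avgKer R.toLinearMap m ↦ y + (1 / 2 : ℝ) • diffOpAvgKer hR y := by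
  have hm' : (1 : ℝ) ≤ m := by exact_mod_cast hm
  have hinv : 0 < 1 / (4 * (m : ℝ) ^ 2) := by positivity
  have hinv' : 1 / (4 * (m : ℝ) ^ 2) ≤ 1 := by
    rw [div_le_one (by positivity)]
    nlinarith
  -- Inserting `‖Sy‖ ≥ ‖y‖/m` into `‖y‖² - ¼‖Sy‖²` gives the factor `q² = 1 - 1/(4m²)`.
  refine ⟨Real.toNNReal √(1 - 1 / (4 * (m : ℝ) ^ 2)), ?_, ?_⟩
  · rw [Real.toNNReal_lt_one, Real.sqrt_lt' one_pos]
    linarith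
  · refine LipschitzWith.of_dist_le_mul fun u v ↦ ?_
    rw [dist_eq_norm, dist_eq_norm, Real.coe_toNNReal _ (Real.sqrt_nonneg _)]
    have hlin : u + (1 / 2 : ℝ) • diffOpAvgKer hR u - (v + (1 / 2 : ℝ) • diffOpAvgKer hR v)
        = (u - v) + (1 / 2 : ℝ) • diffOpAvgKer hR (u - v) := by
      rw [map_sub, smul_sub]
      abel
    rw [hlin]
    generalize u - v = y
    have hbound : ‖(y : X)‖ ^ 2 ≤ (m * ‖diffOp R.toLinearMap (y : X)‖) ^ 2 :=
      pow_le_pow_left₀ (norm_nonneg _) (norm_le_mul_norm_diffOp R hm y.2) 2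
    have hsq : ‖(y : X) + (1 / 2 : ℝ) • diffOp R.toLinearMap (y : X)‖ ^ 2
        = ‖(y : X)‖ ^ 2 - 1 / 4 * ‖diffOp R.toLinearMap (y : X)‖ ^ 2 := by
      rw [norm_add_sq_real, inner_smul_right, inner_diffOp_self, norm_smul]
      norm_num
      ring
    have hkey : ‖(y : X) + (1 / 2 : ℝ) • diffOp R.toLinearMap (y : X)‖ ^ 2
        ≤ (1 - 1 / (4 * (m : ℝ) ^ 2)) * ‖(y : X)‖ ^ 2 := by
      have : 1 / (4 * (m : ℝ) ^ 2) * ‖(y : X)‖ ^ 2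
          ≤ 1 / 4 * ‖diffOp R.toLinearMap (y : X)‖ ^ 2 := by
        rw [div_mul_eq_mul_div, div_le_iff₀ (by positivity)]
        linarith
      rw [hsq]
      linarith
    refine abs_le_of_sq_le_sq' ?_ (by positivity) |>.2
    rw [mul_pow, Real.sq_sqrt (by linarith)]
    exact hkey

end Isometry

section SupportFunction

variable {X : Type*} [NormedAddCommGroup X] [InnerProductSpace ℝ X] {C : Set X}

/-- The inner products with points of the closure of `C` projected to `Y` are below the support
function of `C` on `Y`. -/
lemma coe_inner_le_supportFn (Y : Submodule ℝ X) [Y.HasOrthogonalProjection] {e : Y}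
    (he : e ∈ closure (Y.orthogonalProjectionOnto '' C)) (t : Y) :
    ((⟪(e : X), t⟫_ℝ : ℝ) : EReal) ≤ supportFn C (t : X) := by
  have hclosed : IsClosed {k : Y | ((⟪(k : X), t⟫_ℝ : ℝ) : EReal) ≤ supportFn C (t : X)} := by
    refine isClosed_le (continuous_coe_real_ereal.comp ?_) continuous_const
    fun_prop
  refine closure_minimal ?_ hclosed he
  rintro _ ⟨c, hc, rfl⟩
  have : ⟪(Y.orthogonalProjectionOnto c : X), (t : X)⟫_ℝ = ⟪c, (t : X)⟫_ℝ := by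
    rw [← Submodule.coe_inner, Submodule.inner_orthogonalProjectionOnto_eq_of_mem_right]
  rw [Set.mem_ofPred_eq, this]
  exact le_iSup₂ (f := fun c (_ : c ∈ C) ↦ ((⟪c, (t : X)⟫_ℝ : ℝ) : EReal)) c hc

end SupportFunction

end CyclicProjections

theorem lemma5p5 {X : Type*} [NormedAddCommGroup X] [InnerProductSpace ℝ X] [CompleteSpace X]
    (m : ℕ) (hm : 1 ≤ m) (R : X →ₗᵢ[ℝ] X) (hR : R.toLinearMap ^ m = LinearMap.id)
    (C : Set X) (hCne : C.Nonempty) (hCclosed : IsClosed C) (hCconv : Convex ℝ C) :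
    ∃ d e : CyclicProjections.avgKer R.toLinearMap m,
      (∀ x : X,
        CyclicProjections.supportFn C (CyclicProjections.diffOp R.toLinearMap e)
          + ((⟪CyclicProjections.diffOp R.toLinearMap x
                - CyclicProjections.diffOp R.toLinearMap e, (e : X)⟫_ℝ : ℝ) : EReal)
          - CyclicProjections.supportFn C (CyclicProjections.diffOp R.toLinearMap x) ≤ 0) ∧
      (d : X) = CyclicProjections.diffOp R.toLinearMap e ∧
      d ∈ CyclicProjections.setD R.toLinearMap m C := by
  open CyclicProjections in
  have : CompleteSpace (avgKer R.toLinearMap m) := (isClosed_avgKer R m).completeSpace_coe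
  set Y := avgKer R.toLinearMap m with hY
  -- The projected set need not be closed; taking the closure does not change its support function.
  set K : Set Y := closure (Y.orthogonalProjectionOnto '' C) with hK
  have hKconv : Convex ℝ K :=
    (hCconv.linear_image (Y.orthogonalProjectionOnto : X →ₗ[ℝ] Y)).closure
  obtain ⟨q, hq⟩ := exists_contractingWith_add_half_diffOp R hm hR
  obtain ⟨e, heK, he⟩ := exists_inner_le_zero_of_contractingWith
    (hCne.image Y.orthogonalProjectionOnto).closure isClosed_closure hKconv hq
  have hsupp : supportFn C (diffOp R.toLinearMap (e : X))
      = ((⟪(e : X), diffOp R.toLinearMap (e : X)⟫_ℝ : ℝ) : EReal) := by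
    -- The upper bound is the variational inequality at the projection of `c`; the lower bound is `e
    -- ∈ K`.
    refine le_antisymm (iSup₂_le fun c hc ↦ EReal.coe_le_coe_iff.2 ?_)
      (coe_inner_le_supportFn Y heK (diffOpAvgKer hR e))
    have hc' := he _ (subset_closure (Set.mem_image_of_mem Y.orthogonalProjectionOnto hc))
    have hproj : ⟪diffOpAvgKer hR e, Y.orthogonalProjectionOnto c⟫_ℝ
        = ⟪c, diffOp R.toLinearMap (e : X)⟫_ℝ := by
      rw [real_inner_comm, Submodule.inner_orthogonalProjectionOnto_eq_of_mem_right, coe_diffOpAvgKer]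
    rw [inner_smul_left, inner_sub_right, hproj, Submodule.coe_inner, coe_diffOpAvgKer,
      real_inner_comm (e : X)] at hc'
    norm_num at hc'
    linarith
  refine ⟨diffOpAvgKer hR e, e, fun x ↦ ?_, rfl, ?_⟩
  · have hx := coe_inner_le_supportFn Y heK
      ⟨diffOp R.toLinearMap x, diffOp_mem_avgKer hR x⟩
    rw [hsupp, ← EReal.coe_add, inner_sub_left, real_inner_comm (e : X),
      real_inner_comm (e : X), add_sub_cancel]
    exact EReal.sub_nonpos.2 hx
  · rw [setD, Set.mem_ofPred_eq, coe_diffOpAvgKer, hsupp, inner_diffOp_self, ← EReal.coe_add,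
      neg_add_cancel, EReal.coe_zero]
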